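/- Let $F^2$ be the Fock space: the Hilbert space of all entire functions $f$ with $\|f\|^2=\int_{\mathbb C}|f|^2\,d\lambda<\infty$, where $d\lambda(z)=\frac1\pi e^{-|z|^2}\,dA(z)$ and $dA$ is area measure on $\mathbb C$, and let $k_w(z)=e^{-|w|^2/2+z\overline w}$ be its normalized reproducing kernel at $w\in\mathbb C$. On $L^2(\mathbb R)$ put $T_af(x)=f(x-a)$ and $M_bf(x)=e^{2\pi bix}f(x)$ for $a,b\in\mathbb R$, and let $g(x)=e^{-x^2}$ be the Gauss window. Let $(a_n)_{n\ge1}$ and $(b_n)_{n\ge1}$ be sequences of real numbers such that the points $z_n=a_n-\pi b_n i\in\mathbb C$ are distinct. Then the following three conditions are equivalent. (1) $\{M_{b_n}T_{a_n}g\}$ is a Gabor frame for $L^2(\mathbb R)$: there is a constant $C>0$ such that $$C^{-1}\|f\|^2\le\sum_{n=1}^\infty|\langle f,M_{b_n}T_{a_n}g\rangle|^2\le C\|f\|^2\qquad\text{for all } f\in L^2(\mathbb R).$$ (2) $\{z_n\}$ is a sampling sequence for $F^2$: there is a constant $C>0$ such that $$C^{-1}\|f\|^2\le\sum_{n=1}^\infty|f(z_n)|^2e^{-|z_n|^2}\le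 C\|f\|^2\qquad\text{for all } f\in F^2.$$ (3) Atomic decomposition for $F^2$ holds on $\{z_n\}$: for every $(c_n)\in\ell^2$ the series $\sum_{n=1}^\infty c_nk_{z_n}$ converges in the norm of $F^2$, and for every $f\in F^2$ there is $(c_n)\in\ell^2$ with $f=\sum_{n=1}^\infty c_nk_{z_n}$ (convergence in the norm of $F^2$). -/

import Mathlib

open MeasureTheory Filter Topology

noncomputable section

namespace FockGabor

/-! ### Frames -/

/-- A sequence `u` in an inner product space is a frame if, for some constant `C > 0`,
`C⁻¹ ‖f‖² ≤ ∑ |⟨f, uₙ⟩|² ≤ C ‖f‖²` for every `f` (in particular the series converges). -/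
def IsFrame {H : Type*} [NormedAddCommGroup H] [InnerProductSpace ℂ H] (u : ℕ → H) : Prop :=
  ∃ C : ℝ, 0 < C ∧ ∀ f : H,
    Summable (fun n => ‖inner ℂ f (u n)‖ ^ 2) ∧
    C⁻¹ * ‖f‖ ^ 2 ≤ ∑' n, ‖inner ℂ f (u n)‖ ^ 2 ∧
    ∑' n, ‖inner ℂ f (u n)‖ ^ 2 ≤ C * ‖f‖ ^ 2

/-! ### Translation, modulation and the Gauss window on `L²(ℝ)` -/

/-- The Hilbert space `L²(ℝ)` of complex-valued functions, with respect to Lebesgue measure. -/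
abbrev L2R : Type := Lp ℂ 2 (volume : Measure ℝ)

/-- The translation operator `(T_a f)(x) = f (x - a)` on `L²(ℝ)`. -/
def translation (a : ℝ) (f : L2R) : L2R :=
  Lp.compMeasurePreserving (fun x : ℝ => x - a) (measurePreserving_sub_right volume a) f

theorem memLp_modulation (b : ℝ) (f : L2R) :
    MemLp (fun x : ℝ => Complex.exp (2 * Real.pi * b * Complex.I * x) * f x) 2 volume := by
  refine (Lp.memLp f).of_le ?_ (Eventually.of_forall fun x => ?_)
  · exact (Continuous.aestronglyMeasurable (by fun_prop)).mul (Lp.aestronglyMeasurable f)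
  · have h : (2 * Real.pi * b * Complex.I * x : ℂ) = ((2 * Real.pi * b * x : ℝ) : ℂ) * Complex.I := by
      push_cast; ring
    rw [norm_mul, h, Complex.norm_exp_ofReal_mul_I, one_mul]

/-- The modulation operator `(M_b f)(x) = e^{2πbix} f(x)` on `L²(ℝ)`. -/
def modulation (b : ℝ) (f : L2R) : L2R := (memLp_modulation b f).toLp

theorem memLp_gauss : MemLp (fun x : ℝ => Complex.exp (-(x : ℂ) ^ 2)) 2 volume := by
  rw [memLp_two_iff_integrable_sq_norm (Continuous.aestronglyMeasurable (by fun_prop))]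
  refine (integrable_exp_neg_mul_sq (b := 2) (by norm_num)).congr (Eventually.of_forall fun x => ?_)
  have h : (-(x : ℂ) ^ 2) = ((-x ^ 2 : ℝ) : ℂ) := by push_cast; ring
  simp only [h, Complex.norm_exp, Complex.ofReal_re]
  rw [← Real.exp_nat_mul]
  congr 1
  push_cast; ring

/-- The Gauss window `g(x) = e^{-x²}` as an element of `L²(ℝ)`. -/
def gaussWindow : L2R := memLp_gauss.toLp

/-- The system `{M_{b_n} T_{a_n} g}` is a Gabor frame for `L²(ℝ)`. -/
def IsGaborFrame (a b : ℕ → ℝ) (g : L2R) : Prop :=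
  IsFrame (fun n => modulation (b n) (translation (a n) g))

/-! ### The Fock space -/

/-- The Gaussian measure `dλ(z) = π⁻¹ e^{-|z|²} dA(z)` on the complex plane. -/
def gaussMeasure : Measure ℂ :=
  volume.withDensity fun z => ENNReal.ofReal (Real.pi⁻¹ * Real.exp (-‖z‖ ^ 2))

/-- The space of entire functions which are square integrable with respect to `gaussMeasure`. -/
def fockSubmodule : Submodule ℂ (ℂ → ℂ) where
  carrier := {f | Differentiable ℂ f ∧ MemLp f 2 gaussMeasure}
  add_mem' hf hg := ⟨hf.1.add hg.1, hf.2.add hg.2⟩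
  zero_mem' := ⟨differentiable_const 0, MemLp.zero⟩
  smul_mem' c _ hf := ⟨hf.1.const_smul c, hf.2.const_smul c⟩

/-- The Fock space `F²`. This is a separate type, so that it does not inherit the topology of
pointwise convergence from `ℂ → ℂ`. -/
def FockSpace : Type := fockSubmodule

namespace FockSpace

instance : AddCommGroup FockSpace := inferInstanceAs (AddCommGroup fockSubmodule)
instance : Module ℂ FockSpace := inferInstanceAs (Module ℂ fockSubmodule)

instance : CoeFun FockSpace (fun _ => ℂ → ℂ) := ⟨fun f => f.1⟩

/-- The inclusion of `F²` in `L²(ℂ, dλ)`. -/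
def toL2 : FockSpace →ₗ[ℂ] Lp ℂ 2 gaussMeasure where
  toFun f := f.2.2.toLp
  map_add' _ _ := rfl
  map_smul' _ _ := rfl

theorem volume_absolutelyContinuous : (volume : Measure ℂ) ≪ gaussMeasure := by
  refine withDensity_absolutelyContinuous' (by fun_prop) (Eventually.of_forall fun z => ?_)
  simp only [ne_eq, ENNReal.ofReal_eq_zero, not_le]
  positivity

theorem toL2_injective : Function.Injective toL2 := by
  intro f g h
  have h1 : f.1 =ᵐ[gaussMeasure] g.1 := (MemLp.toLp_eq_toLp_iff f.2.2 g.2.2).1 h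
  have h2 : f.1 =ᵐ[volume] g.1 := volume_absolutelyContinuous.ae_le h1
  exact Subtype.ext ((Continuous.ae_eq_iff_eq volume f.2.1.continuous g.2.1.continuous).1 h2)

/-- The norm of `F²` is inherited from `L²(ℂ, dλ)`. -/
instance : NormedAddCommGroup FockSpace :=
  NormedAddCommGroup.induced FockSpace (Lp ℂ 2 gaussMeasure) toL2 toL2_injective

/-- The inner product of `F²` is inherited from `L²(ℂ, dλ)`. -/
instance : InnerProductSpace ℂ FockSpace where
  toNormedSpace := NormedSpace.induced ℂ FockSpace (Lp ℂ 2 gaussMeasure) toL2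
  inner f g := inner ℂ (toL2 f) (toL2 g)
  norm_sq_eq_re_inner f := norm_sq_eq_re_inner (𝕜 := ℂ) (toL2 f)
  conj_inner_symm f g := inner_conj_symm (toL2 f) (toL2 g)
  add_left f g h := by rw [map_add, inner_add_left]
  smul_left f g c := by rw [map_smul, inner_smul_left]

/-- The norm of `F²` is `‖f‖² = ∫ |f|² dλ`. -/
theorem norm_sq_eq_integral (f : FockSpace) : ‖f‖ ^ 2 = ∫ z, ‖f z‖ ^ 2 ∂gaussMeasure := by
  have h : ‖f‖ ^ 2 = RCLike.re (inner ℂ (toL2 f) (toL2 f)) :=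
    norm_sq_eq_re_inner (𝕜 := ℂ) (toL2 f)
  rw [h, L2.inner_def, ← integral_re (L2.integrable_inner _ _)]
  refine integral_congr_ae ?_
  filter_upwards [MemLp.coeFn_toLp f.2.2] with z hz
  have hz' : (toL2 f : ℂ → ℂ) z = f z := hz
  rw [hz', ← norm_sq_eq_re_inner (𝕜 := ℂ)]

end FockSpace

/-- The normalized reproducing kernel `k_w(z) = e^{-|w|²/2 + z w̄}` as a function. -/
def normalizedKernelFun (w z : ℂ) : ℂ :=
  Complex.exp (-(‖w‖ : ℂ) ^ 2 / 2 + z * (starRingEnd ℂ) w)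

theorem normalizedKernelFun_mem (w : ℂ) : normalizedKernelFun w ∈ fockSubmodule := by
  have hd : Differentiable ℂ (normalizedKernelFun w) := by
    unfold normalizedKernelFun; fun_prop
  refine ⟨hd, ?_⟩
  rw [memLp_two_iff_integrable_sq_norm hd.continuous.aestronglyMeasurable, gaussMeasure,
    integrable_withDensity_iff (by fun_prop) (Eventually.of_forall fun _ => ENNReal.ofReal_lt_top)]
  have hi : Integrable (fun z : ℂ => Real.exp (-‖z‖ ^ 2)) := by
    have h := (GaussianFourier.integrable_cexp_neg_mul_sq_norm_add (V := ℂ) (b := 1)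
      (by norm_num) 0 0).norm
    refine h.congr (Eventually.of_forall fun z => ?_)
    have : (-1 * (‖z‖ : ℂ) ^ 2 + 0 * ((inner ℝ (0 : ℂ) z : ℝ) : ℂ)) = ((-‖z‖ ^ 2 : ℝ) : ℂ) := by
      push_cast; ring
    simp only [this, Complex.norm_exp, Complex.ofReal_re]
  refine ((hi.comp_sub_right w).const_mul Real.pi⁻¹).congr (Eventually.of_forall fun z => ?_)
  have hpos : 0 ≤ Real.pi⁻¹ * Real.exp (-‖z‖ ^ 2) := by positivity
  simp only [normalizedKernelFun, ENNReal.toReal_ofReal hpos, Complex.norm_exp]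
  rw [← Real.exp_nat_mul, mul_left_comm, ← Real.exp_add]
  congr 2
  have h1 : (-(‖w‖ : ℂ) ^ 2 / 2).re = -‖w‖ ^ 2 / 2 := by
    have : (-(‖w‖ : ℂ) ^ 2 / 2) = ((-‖w‖ ^ 2 / 2 : ℝ) : ℂ) := by push_cast; ring
    rw [this, Complex.ofReal_re]
  rw [Complex.add_re, h1, ← Complex.normSq_eq_norm_sq, ← Complex.normSq_eq_norm_sq,
    ← Complex.normSq_eq_norm_sq, Complex.normSq_sub]
  push_cast; ring

/-- The normalized reproducing kernel `k_w` as an element of `F²`. -/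
def normalizedKernel (w : ℂ) : FockSpace := ⟨normalizedKernelFun w, normalizedKernelFun_mem w⟩

/-! ### Sampling sequences and atomic decomposition -/

/-- The sequence `z` is sampling for `F²`: for some constant `C > 0`,
`C⁻¹ ‖f‖² ≤ ∑ |f(zₙ)|² e^{-|zₙ|²} ≤ C ‖f‖²` for every `f ∈ F²`
(in particular the series converges). -/
def IsSampling (z : ℕ → ℂ) : Prop :=
  ∃ C : ℝ, 0 < C ∧ ∀ f : FockSpace,
    Summable (fun n => ‖f (z n)‖ ^ 2 * Real.exp (-‖z n‖ ^ 2)) ∧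
    C⁻¹ * ‖f‖ ^ 2 ≤ ∑' n, ‖f (z n)‖ ^ 2 * Real.exp (-‖z n‖ ^ 2) ∧
    ∑' n, ‖f (z n)‖ ^ 2 * Real.exp (-‖z n‖ ^ 2) ≤ C * ‖f‖ ^ 2

/-- The series `∑ cₙ k_{zₙ}` converges to `f` in the norm of `F²`
(convergence of the sequence of partial sums). -/
def KernelSeriesConvergesTo (z : ℕ → ℂ) (c : ℕ → ℂ) (f : FockSpace) : Prop :=
  Tendsto (fun N => ∑ n ∈ Finset.range N, c n • normalizedKernel (z n)) atTop (𝓝 f)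

/-- Atomic decomposition for `F²` holds on the sequence `z`: every series `∑ cₙ k_{zₙ}` with
`c ∈ ℓ²` converges in `F²`, and every `f ∈ F²` is the sum of such a series. -/
def AtomicDecomposition (z : ℕ → ℂ) : Prop :=
  (∀ c : ℕ → ℂ, Memℓp c 2 → ∃ f : FockSpace, KernelSeriesConvergesTo z c f) ∧
  ∀ f : FockSpace, ∃ c : ℕ → ℂ, Memℓp c 2 ∧ KernelSeriesConvergesTo z c f

end FockGabor

end

noncomputable section

namespace FockGabor

/-! ### Frames, Gram matrices and synthesis operators in Hilbert spaces. -/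

section Hilbert

variable {H H' : Type*} [NormedAddCommGroup H] [InnerProductSpace ℂ H]
  [NormedAddCommGroup H'] [InnerProductSpace ℂ H']

/-! All three conditions say that the kernels `k_{z_n}` form a frame for `F²`. Sampling is this
verbatim, since `|⟨f, k_z⟩|² = |f(z)|² e^{-|z|²}` by the reproducing property
`inner_normalizedKernel`. Atomic decomposition is the dual form: a sequence in a Hilbert space is a
frame iff its synthesis map `c ↦ ∑ cₙ uₙ` is bounded from `ℓ²` onto the space
(`isFrame_iff_series`). The Gabor system is carried to the kernels by the Bargmann transform, up to
unimodular factors and the constant `(π/2)^{1/4}`. No integral formula is needed for it: over all `w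
∈ ℂ`, the atoms `gaborAtom w` and `bargmannAtom w` are total and have the same Gram matrix, so
`exists_linearIsometryEquiv_of_inner_eq` gives the unitary map. This requires `F²` to be complete.
-/

theorem IsFrame.of_linearIsometryEquiv {u : ℕ → H} {v : ℕ → H'} (U : H' ≃ₗᵢ[ℂ] H) {κ : ℝ}
    (hκ : 0 < κ) (h : ∀ f n, ‖inner ℂ f (v n)‖ ^ 2 = κ * ‖inner ℂ (U f) (u n)‖ ^ 2)
    (hu : IsFrame u) : IsFrame v := by
  obtain ⟨C, hC, hf⟩ := hu
  have key : ∀ f, Summable (fun n => ‖inner ℂ f (v n)‖ ^ 2) ∧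
      κ * C⁻¹ * ‖f‖ ^ 2 ≤ ∑' n, ‖inner ℂ f (v n)‖ ^ 2 ∧
      ∑' n, ‖inner ℂ f (v n)‖ ^ 2 ≤ κ * C * ‖f‖ ^ 2 := by
    intro f
    obtain ⟨h1, h2, h3⟩ := hf (U f)
    rw [U.norm_map] at h2 h3
    simp only [h, tsum_mul_left, mul_assoc]
    exact ⟨h1.mul_left κ, mul_le_mul_of_nonneg_left h2 hκ.le, mul_le_mul_of_nonneg_left h3 hκ.le⟩
  -- The bounds become `κ C⁻¹` and `κ C`; a single constant must dominate `κ C` and the inverse of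
  -- `κ C⁻¹`.
  refine ⟨max (κ * C) (κ⁻¹ * C), lt_max_of_lt_left (by positivity), fun f => ?_⟩
  obtain ⟨h1, h2, h3⟩ := key f
  refine ⟨h1, le_trans ?_ h2, h3.trans ?_⟩
  · gcongr
    have : κ * C⁻¹ = (κ⁻¹ * C)⁻¹ := by rw [mul_inv, inv_inv]
    rw [this]
    exact inv_anti₀ (by positivity) (le_max_right _ _)
  · gcongr
    exact le_max_left _ _

theorem denseRange_linearCombination {ι : Type*} [CompleteSpace H] {u : ι → H}
    (hu : ∀ f, (∀ i, inner ℂ (u i) f = 0) → f = 0) :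
    DenseRange (Finsupp.linearCombination ℂ u) := by
  have h : (Submodule.span ℂ (Set.range u))ᗮ = ⊥ := by
    rw [eq_bot_iff]
    intro f hf
    exact hu f fun i => hf (u i) (Submodule.subset_span ⟨i, rfl⟩)
  have h2 := (Submodule.topologicalClosure_eq_top_iff).2 h
  have h3 : Set.range (Finsupp.linearCombination ℂ u) = (Submodule.span ℂ (Set.range u) : Set H) := by
    rw [← Finsupp.range_linearCombination]; rfl
  rw [DenseRange, h3]
  exact (Submodule.dense_iff_topologicalClosure_eq_top).2 h2

theorem inner_linearCombination {ι : Type*} (u : ι → H) (x y : ι →₀ ℂ) :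
    inner ℂ (Finsupp.linearCombination ℂ u x) (Finsupp.linearCombination ℂ u y) =
      x.sum fun i a => y.sum fun j b => (starRingEnd ℂ) a * (b * inner ℂ (u i) (u j)) := by
  simp only [Finsupp.linearCombination_apply, Finsupp.sum, sum_inner, inner_sum, inner_smul_left,
    inner_smul_right, Finset.mul_sum]
  rw [Finset.sum_comm]
  exact Finset.sum_congr rfl fun i _ => Finset.sum_congr rfl fun j _ => mul_left_comm _ _ _

/-- Two total families with the same Gram matrix are unitarily equivalent. -/
theorem exists_linearIsometryEquiv_of_inner_eq {ι : Type*} [CompleteSpace H] [CompleteSpace H']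
    {u : ι → H} {v : ι → H'} (hu : ∀ f, (∀ i, inner ℂ (u i) f = 0) → f = 0)
    (hv : ∀ f, (∀ i, inner ℂ (v i) f = 0) → f = 0)
    (h : ∀ i j, inner ℂ (u i) (u j) = inner ℂ (v i) (v j)) :
    ∃ U : H ≃ₗᵢ[ℂ] H', ∀ i, U (u i) = v i := by
  -- The Gram matrix determines the norm of every finite combination, so matching coefficients is
  -- isometric between dense subspaces.
  have hn : ∀ x, ‖Finsupp.linearCombination ℂ v (LinearEquiv.refl ℂ (ι →₀ ℂ) x)‖ =
      ‖Finsupp.linearCombination ℂ u x‖ := by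
    intro x
    rw [← sq_eq_sq₀ (norm_nonneg _) (norm_nonneg _), norm_sq_eq_re_inner (𝕜 := ℂ),
      norm_sq_eq_re_inner (𝕜 := ℂ), inner_linearCombination, LinearEquiv.refl_apply,
      inner_linearCombination]
    simp only [h]
  refine ⟨(LinearEquiv.refl ℂ (ι →₀ ℂ)).extendOfIsometry (Finsupp.linearCombination ℂ u)
    (Finsupp.linearCombination ℂ v) (denseRange_linearCombination hu)
    (denseRange_linearCombination hv) hn, fun i => ?_⟩
  have := LinearEquiv.extendOfIsometry_eq (LinearEquiv.refl ℂ (ι →₀ ℂ))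
    (Finsupp.linearCombination ℂ u) (Finsupp.linearCombination ℂ v)
    (denseRange_linearCombination hu) (denseRange_linearCombination hv) hn (Finsupp.single i 1)
  simpa using this

theorem lp_two_norm_sq (c : lp (fun _ : ℕ => ℂ) 2) : ‖c‖ ^ 2 = ∑' n, ‖c n‖ ^ 2 := by
  have := lp.norm_rpow_eq_tsum (p := 2) (by norm_num) c
  simpa using this

theorem memℓp_two_iff_summable (c : ℕ → ℂ) : Memℓp c 2 ↔ Summable fun n => ‖c n‖ ^ 2 := by
  rw [memℓp_gen_iff (by norm_num)]
  simp

variable [CompleteSpace H]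

/-- A frame has a bounded, surjective synthesis operator. -/
theorem IsFrame.exists_synthesis {u : ℕ → H} (hu : IsFrame u) :
    ∃ T : lp (fun _ : ℕ => ℂ) 2 →L[ℂ] H, Function.Surjective T ∧
      ∀ n, T (lp.single 2 n 1) = u n := by
  obtain ⟨C, hC, hf⟩ := hu
  have hmem : ∀ f : H, Memℓp (fun n => inner ℂ (u n) f) 2 := fun f => by
    rw [memℓp_two_iff_summable]
    simpa only [norm_inner_symm] using (hf f).1
  let A₀ : H →ₗ[ℂ] lp (fun _ : ℕ => ℂ) 2 :=
    { toFun := fun f => ⟨fun n => inner ℂ (u n) f, hmem f⟩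
      map_add' := fun f g => by ext n; exact inner_add_right _ _ _
      map_smul' := fun c f => by ext n; exact inner_smul_right _ _ _ }
  have hA₀ : ∀ f, ‖A₀ f‖ ^ 2 = ∑' n, ‖inner ℂ f (u n)‖ ^ 2 := fun f => by
    rw [lp_two_norm_sq]
    exact tsum_congr fun n => by rw [norm_inner_symm]; rfl
  let A : H →L[ℂ] lp (fun _ : ℕ => ℂ) 2 := A₀.mkContinuous (Real.sqrt C) fun f => by
    refine (sq_le_sq₀ (norm_nonneg _) (by positivity)).1 ?_
    rw [hA₀, mul_pow, Real.sq_sqrt hC.le]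
    exact (hf f).2.2
  have hA : ∀ f, ‖A f‖ ^ 2 = ∑' n, ‖inner ℂ f (u n)‖ ^ 2 := hA₀
  refine ⟨A.adjoint, ?_, fun n => ?_⟩
  -- The lower frame bound makes the frame operator `A*A` coercive, hence invertible; `c = A (A*A)⁻¹
  -- f` is then a preimage of `f` under `A*`.
  · have hunit : IsUnit (A.adjoint ∘L A) := by
      refine ContinuousLinearMap.isUnit_of_forall_le_norm_inner_map _
        (c := ⟨C⁻¹, by positivity⟩) (by exact inv_pos.2 hC) fun f => ?_
      rw [ContinuousLinearMap.comp_apply, ContinuousLinearMap.adjoint_inner_left,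
        inner_self_eq_norm_sq_to_K, norm_pow, RCLike.norm_ofReal, abs_norm, hA, mul_comm]
      exact (hf f).2.1
    intro f
    obtain ⟨g, hg⟩ := (ContinuousLinearMap.isUnit_iff_bijective.1 hunit).2 f
    exact ⟨A g, hg⟩
  · refine ext_inner_right ℂ fun f => ?_
    rw [ContinuousLinearMap.adjoint_inner_left, lp.inner_single_left]
    simp [A, A₀]

theorem tendsto_sum_single (c : lp (fun _ : ℕ => ℂ) 2) :
    Tendsto (fun N => ∑ n ∈ Finset.range N, c n • lp.single (E := fun _ : ℕ => ℂ) 2 n (1 : ℂ))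
      atTop (𝓝 c) := by
  have := (lp.hasSum_single (p := 2) (by norm_num) c).tendsto_sum_nat
  refine this.congr fun N => Finset.sum_congr rfl fun n _ => ?_
  rw [← lp.single_smul, smul_eq_mul, mul_one]

/-- A sequence in a Hilbert space is a frame iff it is the image of the standard basis under a
bounded surjection from `ℓ²`, expressed in terms of convergence of series. -/
theorem isFrame_iff_series {u : ℕ → H} :
    IsFrame u ↔
      (∀ c : ℕ → ℂ, Memℓp c 2 → ∃ f : H,
        Tendsto (fun N => ∑ n ∈ Finset.range N, c n • u n) atTop (𝓝 f)) ∧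
      ∀ f : H, ∃ c : ℕ → ℂ, Memℓp c 2 ∧
        Tendsto (fun N => ∑ n ∈ Finset.range N, c n • u n) atTop (𝓝 f) := by
  constructor
  · intro hu
    obtain ⟨T, hsurj, hT⟩ := hu.exists_synthesis
    have hconv : ∀ c : lp (fun _ : ℕ => ℂ) 2,
        Tendsto (fun N => ∑ n ∈ Finset.range N, c n • u n) atTop (𝓝 (T c)) := fun c => by
      have := (T.continuous.tendsto c).comp (tendsto_sum_single c)
      refine this.congr fun N => ?_
      simp [hT]
    refine ⟨fun c hc => ⟨T ⟨c, hc⟩, hconv ⟨c, hc⟩⟩, fun f => ?_⟩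
    obtain ⟨c, rfl⟩ := hsurj f
    exact ⟨c, c.2, hconv c⟩
  · rintro ⟨h1, h2⟩
    choose F hF using h1
    let P : ℕ → lp (fun _ : ℕ => ℂ) 2 →L[ℂ] H := fun N =>
      ∑ n ∈ Finset.range N, (lp.evalCLM ℂ (fun _ : ℕ => ℂ) 2 n).smulRight (u n)
    have hP : ∀ N c, P N c = ∑ n ∈ Finset.range N, c n • u n := fun N c => by
      simp only [P, sum_apply, ContinuousLinearMap.smulRight_apply]
      rfl
    -- Banach–Steinhaus: a pointwise limit of the bounded partial-sum operators is bounded.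
    let T : lp (fun _ : ℕ => ℂ) 2 →L[ℂ] H :=
      continuousLinearMapOfTendsto P (f := fun c => F c c.2) (l := atTop) <| by
        rw [tendsto_pi_nhds]
        intro c
        simpa only [hP] using hF c c.2
    have hTF : ∀ c, T c = F c c.2 := fun c => rfl
    have hT : ∀ n, T (lp.single 2 n 1) = u n := fun n => by
      rw [hTF]
      refine tendsto_nhds_unique (hF _ _) (tendsto_const_nhds.congr' ?_)
      filter_upwards [eventually_gt_atTop n] with N hN
      rw [Finset.sum_eq_single_of_mem n (Finset.mem_range.2 hN)]
      · simp
      · intro m _ hm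
        rw [lp.single_apply_ne _ _ _ hm, zero_smul]
    have hsurj : Function.Surjective T := fun f => by
      obtain ⟨c, hc, hcf⟩ := h2 f
      exact ⟨⟨c, hc⟩, tendsto_nhds_unique (hF c hc) hcf⟩
    have hadj : ∀ f n, T.adjoint f n = inner ℂ (u n) f := fun f n => by
      rw [← hT n, ← ContinuousLinearMap.adjoint_inner_right, lp.inner_single_left]
      simp
    have hnorm : ∀ f n, ‖inner ℂ f (u n)‖ = ‖T.adjoint f n‖ := fun f n => by
      rw [hadj, norm_inner_symm]
    -- The open mapping theorem bounds preimages under `T`; pairing `f = T c` with `f` turns this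
    -- into a lower bound for the adjoint.
    obtain ⟨K, hK, hpre⟩ := T.exists_preimage_norm_le hsurj
    have hlow : ∀ f, ‖f‖ ≤ K * ‖T.adjoint f‖ := fun f => by
      obtain ⟨c, hc, hcn⟩ := hpre f
      rcases eq_or_ne f 0 with rfl | hf
      · simp
      · have hpos := norm_pos_iff.2 hf
        have : ‖f‖ * ‖f‖ ≤ ‖f‖ * (K * ‖T.adjoint f‖) := by
          calc ‖f‖ * ‖f‖ = ‖inner ℂ (T c) f‖ := by
                rw [hc, inner_self_eq_norm_sq_to_K, norm_pow, RCLike.norm_ofReal, abs_norm, sq]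
            _ = ‖inner ℂ c (T.adjoint f)‖ := by rw [ContinuousLinearMap.adjoint_inner_right]
            _ ≤ ‖c‖ * ‖T.adjoint f‖ := norm_inner_le_norm _ _
            _ ≤ (K * ‖f‖) * ‖T.adjoint f‖ := by gcongr
            _ = _ := by ring
        exact le_of_mul_le_mul_left this hpos
    refine ⟨max (K ^ 2) (‖T.adjoint‖ ^ 2), lt_max_of_lt_left (by positivity), fun f => ?_⟩
    simp only [hnorm]
    rw [← lp_two_norm_sq]
    refine ⟨(memℓp_two_iff_summable _).1 (T.adjoint f).2, ?_, ?_⟩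
    · rw [inv_mul_le_iff₀ (lt_max_of_lt_left (by positivity))]
      calc ‖f‖ ^ 2 ≤ (K * ‖T.adjoint f‖) ^ 2 := by gcongr; exact hlow f
        _ = K ^ 2 * ‖T.adjoint f‖ ^ 2 := mul_pow _ _ _
        _ ≤ _ := by gcongr; exact le_max_left _ _
    · calc ‖T.adjoint f‖ ^ 2 ≤ (‖T.adjoint‖ * ‖f‖) ^ 2 := by
            gcongr; exact T.adjoint.le_opNorm f
        _ = ‖T.adjoint‖ ^ 2 * ‖f‖ ^ 2 := mul_pow _ _ _
        _ ≤ _ := by gcongr; exact le_max_right _ _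

end Hilbert

/-! ### The Gaussian measure and its mean value property. -/

theorem integral_gaussMeasure (f : ℂ → ℂ) :
    ∫ z, f z ∂gaussMeasure =
      ∫ z, ((Real.pi⁻¹ * Real.exp (-‖z‖ ^ 2) : ℝ) : ℂ) * f z := by
  rw [gaussMeasure, integral_withDensity_eq_integral_toReal_smul (by fun_prop)
    (Eventually.of_forall fun _ => ENNReal.ofReal_lt_top)]
  refine integral_congr_ae (Eventually.of_forall fun z => ?_)
  have hpos : 0 ≤ Real.pi⁻¹ * Real.exp (-‖z‖ ^ 2) := by positivity
  simp only [ENNReal.toReal_ofReal hpos, Complex.real_smul]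

theorem integrable_gaussMeasure_iff (f : ℂ → ℂ) :
    Integrable f gaussMeasure ↔
      Integrable fun z => ((Real.pi⁻¹ * Real.exp (-‖z‖ ^ 2) : ℝ) : ℂ) * f z := by
  rw [gaussMeasure, integrable_withDensity_iff_integrable_smul' (by fun_prop)
    (Eventually.of_forall fun _ => ENNReal.ofReal_lt_top)]
  refine integrable_congr (Eventually.of_forall fun z => ?_)
  have hpos : 0 ≤ Real.pi⁻¹ * Real.exp (-‖z‖ ^ 2) := by positivity
  simp only [ENNReal.toReal_ofReal hpos, Complex.real_smul]

instance isProbabilityMeasure_gaussMeasure : IsProbabilityMeasure gaussMeasure := by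
  have hint : ∫ z : ℂ, Real.exp (-‖z‖ ^ 2) = Real.pi := by
    have := GaussianFourier.integral_rexp_neg_mul_sq_norm (V := ℂ) (b := 1) one_pos
    simpa using this
  have hi : Integrable fun z : ℂ => Real.exp (-‖z‖ ^ 2) := by
    by_contra h
    rw [integral_undef h] at hint
    exact Real.pi_ne_zero hint.symm
  constructor
  rw [gaussMeasure, withDensity_apply _ MeasurableSet.univ, Measure.restrict_univ,
    ← ofReal_integral_eq_lintegral_ofReal (hi.const_mul _)
      (Eventually.of_forall fun z => by positivity), integral_const_mul, hint,
    inv_mul_cancel₀ Real.pi_ne_zero, ENNReal.ofReal_one]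

theorem measurePreserving_mul_gaussMeasure {c : ℂ} (hc : ‖c‖ = 1) :
    MeasurePreserving (fun z => c * z) gaussMeasure gaussMeasure := by
  have hvol : MeasurePreserving (fun z : ℂ => c * z) volume volume :=
    (rotation ⟨c, mem_sphere_zero_iff_norm.2 hc⟩).measurePreserving
  refine ⟨hvol.measurable, ?_⟩
  ext s hs
  rw [Measure.map_apply hvol.measurable hs, gaussMeasure,
    withDensity_apply _ (hvol.measurable hs), withDensity_apply _ hs,
    ← hvol.setLIntegral_comp_preimage hs (by fun_prop)]
  simp [hc]

/-- The mean value property of entire functions with respect to the Gaussian measure. -/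
theorem integral_gaussMeasure_eq_apply_zero {f : ℂ → ℂ} (hf : Differentiable ℂ f)
    (hi : Integrable f gaussMeasure) : ∫ z, f z ∂gaussMeasure = f 0 := by
  -- The integral of `f(e^{iθ} z)` over `z` is independent of `θ`, while its integral over `θ` is
  -- `2π f(0)` for each `z`. Fubini compares the two.
  have hmp : ∀ θ, MeasurePreserving (fun z => circleMap 0 1 θ * z) gaussMeasure gaussMeasure :=
    fun θ => measurePreserving_mul_gaussMeasure (by simp)
  have hrot : ∀ θ, ∫ z, f (circleMap 0 1 θ * z) ∂gaussMeasure = ∫ z, f z ∂gaussMeasure :=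
    fun θ => (hmp θ).integral_comp' (f := (Homeomorph.mulLeft₀ (circleMap 0 1 θ)
      (by simp [circleMap])).toMeasurableEquiv) f
  have hcirc : ∀ z, ∫ θ in (0 : ℝ)..2 * Real.pi, f (circleMap 0 1 θ * z) =
      2 * Real.pi * f 0 := fun z => by
    have hd : Differentiable ℂ fun ζ => f (ζ * z) := hf.comp (differentiable_id.mul_const z)
    have := hd.diffContOnCl.circleAverage (c := 0) (R := 1)
    rw [Real.circleAverage_def, zero_mul, Complex.real_smul] at this
    rw [← this]
    push_cast
    rw [mul_inv_cancel_left₀ (by simp [Real.pi_ne_zero])]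
  have hint : Integrable (Function.uncurry fun (θ : ℝ) (z : ℂ) => f (circleMap 0 1 θ * z))
      ((volume.restrict (Set.uIoc 0 (2 * Real.pi))).prod gaussMeasure) := by
    have hcont : Continuous (Function.uncurry fun (θ : ℝ) (z : ℂ) => f (circleMap 0 1 θ * z)) := by
      have := hf.continuous
      have := continuous_circleMap 0 1
      unfold Function.uncurry
      fun_prop
    rw [integrable_prod_iff hcont.aestronglyMeasurable]
    refine ⟨Eventually.of_forall fun θ => (hmp θ).integrable_comp_of_integrable hi, ?_⟩
    have hconst : ∀ θ, ∫ z, ‖f (circleMap 0 1 θ * z)‖ ∂gaussMeasure =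
        ∫ z, ‖f z‖ ∂gaussMeasure :=
      fun θ => (hmp θ).integral_comp' (f := (Homeomorph.mulLeft₀ (circleMap 0 1 θ)
        (by simp [circleMap])).toMeasurableEquiv) fun z => ‖f z‖
    simp only [Function.uncurry, hconst]
    have : IsFiniteMeasure (volume.restrict (Set.uIoc 0 (2 * Real.pi))) := by
      unfold Set.uIoc; infer_instance
    exact integrable_const _
  have hswap := intervalIntegral_integral_swap hint
  simp only [hrot, hcirc] at hswap
  rw [intervalIntegral.integral_const, integral_const, probReal_univ, one_smul, sub_zero,
    Complex.real_smul] at hswap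
  push_cast at hswap
  exact mul_left_cancel₀ (by simp [Real.pi_ne_zero]) hswap

/-- Completing the square: recentring at `z` turns weight times conjugate kernel into the weight
centred at `0` times a function holomorphic in `w`. The reproducing property thus reduces to the
mean value property at `0`. -/
theorem gauss_weight_mul_kernel_add (z w : ℂ) :
    ((Real.pi⁻¹ * Real.exp (-‖w + z‖ ^ 2) : ℝ) : ℂ) *
        (starRingEnd ℂ) (normalizedKernelFun z (w + z)) =
      Complex.exp (-(‖z‖ : ℂ) ^ 2 / 2) *
        (((Real.pi⁻¹ * Real.exp (-‖w‖ ^ 2) : ℝ) : ℂ) *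
          Complex.exp (-(w * (starRingEnd ℂ) z))) := by
  have h1 : ∀ x : ℂ, ((‖x‖ : ℝ) : ℂ) ^ 2 = x * (starRingEnd ℂ) x := fun x => by
    rw [Complex.mul_conj, Complex.normSq_eq_norm_sq]; push_cast; rfl
  simp only [normalizedKernelFun, ← Complex.exp_conj, Complex.ofReal_mul, Complex.ofReal_exp,
    Complex.ofReal_neg, Complex.ofReal_pow]
  rw [mul_assoc, mul_assoc, ← Complex.exp_add, ← Complex.exp_add, mul_left_comm,
    ← Complex.exp_add]
  congr 2
  simp only [h1, map_add, map_mul, map_neg, map_div₀, Complex.conj_conj, map_ofNat]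
  ring

/-! ### The Fock space as a reproducing kernel Hilbert space. -/

namespace FockSpace

theorem coe_toL2 (f : FockSpace) : (toL2 f : ℂ → ℂ) =ᵐ[gaussMeasure] f :=
  MemLp.coeFn_toLp f.2.2

theorem inner_eq_integral (f g : FockSpace) :
    inner ℂ f g = ∫ z, g z * (starRingEnd ℂ) (f z) ∂gaussMeasure := by
  have h : inner ℂ f g = inner ℂ (toL2 f) (toL2 g) := rfl
  rw [h, L2.inner_def]
  refine integral_congr_ae ?_
  filter_upwards [coe_toL2 f, coe_toL2 g] with z hf hg
  rw [hf, hg, RCLike.inner_apply]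

theorem integrable_mul_conj (f g : FockSpace) :
    Integrable (fun z => g z * (starRingEnd ℂ) (f z)) gaussMeasure := by
  refine (L2.integrable_inner (𝕜 := ℂ) (toL2 f) (toL2 g)).congr ?_
  filter_upwards [coe_toL2 f, coe_toL2 g] with z hf hg
  rw [hf, hg, RCLike.inner_apply]

/-- The reproducing property of the normalized kernel. -/
theorem inner_normalizedKernel (z : ℂ) (f : FockSpace) :
    inner ℂ (normalizedKernel z) f = f z * Complex.exp (-(‖z‖ : ℂ) ^ 2 / 2) := by
  set h : ℂ → ℂ := fun w => f (w + z) * Complex.exp (-(w * (starRingEnd ℂ) z)) with hh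
  have hweight : ∀ w : ℂ, ((Real.pi⁻¹ * Real.exp (-‖w + z‖ ^ 2) : ℝ) : ℂ) *
      (f (w + z) * (starRingEnd ℂ) (normalizedKernel z (w + z))) =
      Complex.exp (-(‖z‖ : ℂ) ^ 2 / 2) *
        (((Real.pi⁻¹ * Real.exp (-‖w‖ ^ 2) : ℝ) : ℂ) * h w) := fun w => by
    have := gauss_weight_mul_kernel_add z w
    have hk : normalizedKernel z (w + z) = normalizedKernelFun z (w + z) := rfl
    rw [hk, mul_left_comm, this, hh]
    ring
  have hd : Differentiable ℂ h := by
    have hf : Differentiable ℂ (f : ℂ → ℂ) := f.2.1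
    have h1 : Differentiable ℂ fun w : ℂ => f (w + z) := hf.comp (differentiable_id.add_const z)
    exact h1.mul (by fun_prop)
  have hi : Integrable h gaussMeasure := by
    rw [integrable_gaussMeasure_iff]
    have := ((integrable_gaussMeasure_iff _).1
      (integrable_mul_conj (normalizedKernel z) f)).comp_add_right z
    simp only [hweight] at this
    exact (integrable_const_mul_iff (IsUnit.mk0 _ (Complex.exp_ne_zero _)) _).1 this
  rw [inner_eq_integral, integral_gaussMeasure, ← integral_add_right_eq_self _ z]
  simp only [hweight]
  rw [integral_const_mul, ← integral_gaussMeasure, integral_gaussMeasure_eq_apply_zero hd hi, hh]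
  simp [mul_comm]

theorem norm_inner_normalizedKernel_sq (z : ℂ) (f : FockSpace) :
    ‖inner ℂ f (normalizedKernel z)‖ ^ 2 = ‖f z‖ ^ 2 * Real.exp (-‖z‖ ^ 2) := by
  have h : (-(‖z‖ : ℂ) ^ 2 / 2) = ((-‖z‖ ^ 2 / 2 : ℝ) : ℂ) := by push_cast; rfl
  rw [norm_inner_symm, inner_normalizedKernel, norm_mul, mul_pow, Complex.norm_exp, h,
    Complex.ofReal_re, ← Real.exp_nat_mul]
  congr 2
  push_cast; ring

theorem inner_normalizedKernel_normalizedKernel (w z : ℂ) :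
    inner ℂ (normalizedKernel w) (normalizedKernel z) =
      Complex.exp (-(‖w‖ : ℂ) ^ 2 / 2 - (‖z‖ : ℂ) ^ 2 / 2 + w * (starRingEnd ℂ) z) := by
  rw [inner_normalizedKernel]
  change normalizedKernelFun z w * _ = _
  rw [normalizedKernelFun, ← Complex.exp_add]
  congr 1
  ring

theorem norm_normalizedKernel (z : ℂ) : ‖normalizedKernel z‖ = 1 := by
  have h := inner_self_eq_norm_sq_to_K (𝕜 := ℂ) (normalizedKernel z)
  rw [inner_normalizedKernel_normalizedKernel, Complex.mul_conj, Complex.normSq_eq_norm_sq] at h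
  have h2 : (-(‖z‖ : ℂ) ^ 2 / 2 - (‖z‖ : ℂ) ^ 2 / 2 + ((‖z‖ ^ 2 : ℝ) : ℂ)) = 0 := by
    push_cast; ring
  rw [h2, Complex.exp_zero] at h
  have h3 : ‖normalizedKernel z‖ ^ 2 = 1 := by
    have h4 : ((‖normalizedKernel z‖ : ℝ) : ℂ) ^ 2 = 1 := h.symm
    exact_mod_cast h4
  exact (pow_eq_one_iff_of_nonneg (norm_nonneg _) two_ne_zero).1 h3

theorem eq_zero_of_inner_normalizedKernel {f : FockSpace}
    (h : ∀ z, inner ℂ (normalizedKernel z) f = 0) : f = 0 := by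
  refine Subtype.ext (funext fun z => ?_)
  have := h z
  rw [inner_normalizedKernel] at this
  exact (mul_eq_zero.1 this).resolve_right (Complex.exp_ne_zero _)

/-- Point evaluations satisfy `|f(z)| ≤ e^{|z|²/2} ‖f‖`, so norm convergence is locally uniform and
the `L²` limit has an entire representative. -/
instance : CompleteSpace FockSpace := by
  refine Metric.complete_of_cauchySeq_tendsto fun u hu => ?_
  have hiso : Isometry toL2 := AddMonoidHomClass.isometry_of_norm toL2 fun _ => rfl
  obtain ⟨g, hg⟩ := cauchySeq_tendsto_of_complete (hiso.uniformContinuous.comp_cauchySeq hu)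
  -- The reproducing formula makes sense for any `g` in `L²`, which gives the candidate limit
  -- pointwise.
  set F : ℂ → ℂ := fun z =>
    Complex.exp ((‖z‖ : ℂ) ^ 2 / 2) * inner ℂ (toL2 (normalizedKernel z)) g with hF
  have hu_eq : ∀ n z, u n z = Complex.exp ((‖z‖ : ℂ) ^ 2 / 2) *
      inner ℂ (toL2 (normalizedKernel z)) (toL2 (u n)) := fun n z => by
    have : inner ℂ (toL2 (normalizedKernel z)) (toL2 (u n)) =
      inner ℂ (normalizedKernel z) (u n) := rfl
    rw [this, inner_normalizedKernel, mul_left_comm, ← Complex.exp_add]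
    rw [neg_div, add_neg_cancel, Complex.exp_zero, mul_one]
  have hbound : ∀ n z, ‖F z - u n z‖ ≤ Real.exp (‖z‖ ^ 2 / 2) * ‖g - toL2 (u n)‖ := fun n z => by
    have h : ((‖z‖ : ℂ) ^ 2 / 2) = ((‖z‖ ^ 2 / 2 : ℝ) : ℂ) := by push_cast; rfl
    have hk : ‖toL2 (normalizedKernel z)‖ = 1 := norm_normalizedKernel z
    rw [hu_eq, hF, ← mul_sub, ← inner_sub_right, norm_mul, Complex.norm_exp, h, Complex.ofReal_re]
    gcongr
    simpa [hk] using norm_inner_le_norm (𝕜 := ℂ) (toL2 (normalizedKernel z)) (g - toL2 (u n))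
  have hzero : Tendsto (fun n => ‖g - toL2 (u n)‖) atTop (𝓝 0) := by
    have := (tendsto_iff_norm_sub_tendsto_zero.1 hg)
    refine this.congr fun n => ?_
    rw [norm_sub_rev]; rfl
  have hloc : TendstoLocallyUniformlyOn (fun n z => u n z) F atTop Set.univ := by
    rw [tendstoLocallyUniformlyOn_iff_forall_isCompact isOpen_univ]
    intro K _ hK
    obtain ⟨R, hR⟩ := hK.isBounded.exists_norm_le
    rw [Metric.tendstoUniformlyOn_iff]
    intro ε hε
    have h0 : Tendsto (fun n => Real.exp (R ^ 2 / 2) * ‖g - toL2 (u n)‖) atTop (𝓝 0) := by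
      simpa using hzero.const_mul (Real.exp (R ^ 2 / 2))
    filter_upwards [h0.eventually_lt_const hε] with n hn z hz
    rw [dist_eq_norm]
    refine (hbound n z).trans_lt (lt_of_le_of_lt ?_ hn)
    gcongr
    exact hR z hz
  have hFd : Differentiable ℂ F := by
    rw [← differentiableOn_univ]
    exact hloc.differentiableOn (Eventually.of_forall fun n => (u n).2.1.differentiableOn)
      isOpen_univ
  have hFg : F =ᵐ[gaussMeasure] g := by
    obtain ⟨ns, hns, hae⟩ := (tendstoInMeasure_of_tendsto_Lp hg).exists_seq_tendsto_ae
    have hall : ∀ᵐ z ∂gaussMeasure, ∀ n, (toL2 (u n) : ℂ → ℂ) z = u n z :=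
      ae_all_iff.2 fun n => coe_toL2 (u n)
    filter_upwards [hae, hall] with z h1 h2
    have h3 : Tendsto (fun n => u n z) atTop (𝓝 (F z)) :=
      hloc.tendsto_at (Set.mem_univ z)
    refine tendsto_nhds_unique (h3.comp hns.tendsto_atTop) (h1.congr fun i => ?_)
    exact h2 (ns i)
  have hFm : F ∈ fockSubmodule := ⟨hFd, (memLp_congr_ae hFg).2 (Lp.memLp g)⟩
  let f : FockSpace := ⟨F, hFm⟩
  have hfg : toL2 f = g := by
    refine Lp.ext ?_
    exact (coe_toL2 f).trans hFg
  refine ⟨f, ?_⟩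
  rw [hiso.isUniformInducing.isInducing.tendsto_nhds_iff, hfg]
  exact hg

end FockSpace

/-! ### Sampling and atomic decomposition as frame conditions. -/

theorem isSampling_iff_isFrame (z : ℕ → ℂ) :
    IsSampling z ↔ IsFrame fun n => normalizedKernel (z n) := by
  simp only [IsSampling, IsFrame, FockSpace.norm_inner_normalizedKernel_sq]

theorem atomicDecomposition_iff_isFrame (z : ℕ → ℂ) :
    AtomicDecomposition z ↔ IsFrame fun n => normalizedKernel (z n) :=
  isFrame_iff_series.symm

/-! ### Gabor atoms of the Gauss window. -/

/-- The Fourier transform is injective on integrable functions. -/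
theorem ae_eq_zero_of_fourier_eq_zero {h : ℝ → ℂ} (hi : Integrable h)
    (hz : ∀ ξ : ℝ, FourierTransform.fourier h ξ = 0) : h =ᵐ[volume] 0 := by
  -- The multiplication formula `∫ ĥ ψ = ∫ h ψ̂` shows that `h` annihilates every Fourier transform
  -- of a Schwartz function, hence every test function.
  have hswap : ∀ ψ : SchwartzMap ℝ ℂ, ∫ x, h x • (FourierTransform.fourier ψ) x = 0 := by
    intro ψ
    have key := VectorFourier.integral_fourierIntegral_smul_eq_flip (L := innerₗ ℝ)
      (e := Real.fourierChar) (μ := volume) (ν := volume) Real.continuous_fourierChar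
      continuous_inner hi ψ.integrable
    rw [flip_innerₗ] at key
    have hL : ∀ ξ, VectorFourier.fourierIntegral Real.fourierChar volume (innerₗ ℝ) h ξ = 0 := hz
    simp only [hL, zero_smul, integral_zero] at key
    rw [key]
    rfl
  refine ae_eq_zero_of_integral_contDiff_smul_eq_zero hi.locallyIntegrable fun g hg hgc => ?_
  have hg₁ : HasCompactSupport (Complex.ofRealCLM ∘ g) := hgc.comp_left rfl
  have hg₂ : ContDiff ℝ ((⊤ : ℕ∞) : WithTop ℕ∞) (Complex.ofRealCLM ∘ g) := by fun_prop
  have := hswap (FourierTransform.fourierInv (hg₁.toSchwartzMap hg₂))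
  rw [FourierTransform.fourier_fourierInv_eq] at this
  rw [← this]
  refine integral_congr_ae (Eventually.of_forall fun x => ?_)
  simp [mul_comm]

/-- The time-frequency shift of the Gauss window attached to a point of the complex plane. -/
def gaborAtom (w : ℂ) : L2R := modulation (-w.im / Real.pi) (translation w.re gaussWindow)

/-- With `w = a - πbi`, translation contributes `2ax` and modulation `2πibx` to the exponent;
together they are `2x w̄`. -/
theorem coe_gaborAtom (w : ℂ) : (gaborAtom w : ℝ → ℂ) =ᵐ[volume] fun x =>
    Complex.exp (-(x : ℂ) ^ 2 + 2 * x * (starRingEnd ℂ) w - (w.re : ℂ) ^ 2) := by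
  have h1 : (gaborAtom w : ℝ → ℂ) =ᵐ[volume] _ :=
    MemLp.coeFn_toLp (memLp_modulation (-w.im / Real.pi) (translation w.re gaussWindow))
  have h2 : (translation w.re gaussWindow : ℝ → ℂ) =ᵐ[volume] _ :=
    Lp.coeFn_compMeasurePreserving gaussWindow (measurePreserving_sub_right volume w.re)
  have h3 := (measurePreserving_sub_right volume w.re).quasiMeasurePreserving.ae_eq_comp
    (MemLp.coeFn_toLp memLp_gauss)
  filter_upwards [h1, h2, h3] with x hx1 hx2 hx3
  rw [hx1, hx2]
  have hx4 : ((gaussWindow : ℝ → ℂ) ∘ fun x => x - w.re) x =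
    Complex.exp (-((x - w.re : ℝ) : ℂ) ^ 2) := hx3
  rw [hx4, ← Complex.exp_add]
  congr 1
  have hw : (starRingEnd ℂ) w = w.re - w.im * Complex.I := by
    apply Complex.ext <;> simp
  rw [hw]
  push_cast
  field_simp [Real.pi_ne_zero]
  ring

theorem inner_gaborAtom (w : ℂ) (f : L2R) :
    inner ℂ (gaborAtom w) f =
      ∫ x : ℝ, f x * Complex.exp (-(x : ℂ) ^ 2 + 2 * x * w - (w.re : ℂ) ^ 2) := by
  rw [L2.inner_def]
  refine integral_congr_ae ?_
  filter_upwards [coe_gaborAtom w] with x hx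
  rw [hx, RCLike.inner_apply, ← Complex.exp_conj]
  simp only [map_add, map_sub, map_neg, map_mul, map_pow, Complex.conj_ofReal, Complex.conj_conj,
    map_ofNat]

theorem inner_gaborAtom_gaborAtom (w z : ℂ) :
    inner ℂ (gaborAtom w) (gaborAtom z) = ((Real.sqrt (Real.pi / 2) : ℝ) : ℂ) *
      Complex.exp ((w + (starRingEnd ℂ) z) ^ 2 / 2 - (w.re : ℂ) ^ 2 - (z.re : ℂ) ^ 2) := by
  have h : inner ℂ (gaborAtom w) (gaborAtom z) = ∫ x : ℝ, Complex.exp (-2 * (x : ℂ) ^ 2 +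
      (2 * (w + (starRingEnd ℂ) z)) * x + (-(w.re : ℂ) ^ 2 - (z.re : ℂ) ^ 2)) := by
    rw [inner_gaborAtom]
    refine integral_congr_ae ?_
    filter_upwards [coe_gaborAtom z] with x hx
    rw [hx, ← Complex.exp_add]
    congr 1
    ring
  rw [h, integral_cexp_quadratic (by norm_num), Real.sqrt_eq_rpow,
    Complex.ofReal_cpow (by positivity)]
  congr 1
  · norm_num
  · congr 1; ring

theorem integrable_mul_gauss (f : L2R) :
    Integrable fun x : ℝ => f x * Complex.exp (-(x : ℂ) ^ 2) :=
  (Lp.memLp f).integrable_mul memLp_gauss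

/-- Purely imaginary `w` already suffice: those atoms are `e^{-x²}` times characters, and `w = -πξi`
tests the Fourier transform of `f(x) e^{-x²}` at `ξ`. -/
theorem eq_zero_of_inner_gaborAtom {f : L2R} (h : ∀ w, inner ℂ (gaborAtom w) f = 0) : f = 0 := by
  have hz : ∀ ξ : ℝ, FourierTransform.fourier
      (fun x : ℝ => f x * Complex.exp (-(x : ℂ) ^ 2)) ξ = 0 := fun ξ => by
    rw [Real.fourier_real_eq_integral_exp_smul, ← h (-(Real.pi * ξ : ℝ) * Complex.I),
      inner_gaborAtom]
    refine integral_congr_ae (Eventually.of_forall fun x => ?_)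
    simp only [smul_eq_mul]
    rw [mul_left_comm, ← Complex.exp_add]
    congr 2
    simp
    ring
  refine (Lp.eq_zero_iff_ae_eq_zero).2 ?_
  filter_upwards [ae_eq_zero_of_fourier_eq_zero (integrable_mul_gauss f) hz] with x hx
  exact (mul_eq_zero.1 hx).resolve_right (Complex.exp_ne_zero _)

/-! ### The Bargmann transform. -/

/-- The unimodular factor relating time-frequency shifts to normalized kernels. -/
def bargmannPhase (w : ℂ) : ℂ := Complex.exp (w ^ 2 / 2 - (w.re : ℂ) ^ 2 + (‖w‖ : ℂ) ^ 2 / 2)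

theorem norm_bargmannPhase (w : ℂ) : ‖bargmannPhase w‖ = 1 := by
  have h : (w ^ 2 / 2 - (w.re : ℂ) ^ 2 + (‖w‖ : ℂ) ^ 2 / 2) = ((w.re * w.im : ℝ) : ℂ) * Complex.I := by
    rw [← Complex.ofReal_pow ‖w‖, ← Complex.normSq_eq_norm_sq, Complex.normSq_apply]
    nth_rewrite 1 [← Complex.re_add_im w]
    push_cast
    linear_combination (w.im : ℂ) ^ 2 / 2 * Complex.I_sq
  rw [bargmannPhase, h, Complex.norm_exp_ofReal_mul_I]

/-- The image of `gaborAtom w` under the Bargmann transform, up to normalization of the latter. -/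
def bargmannAtom (w : ℂ) : FockSpace :=
  (((Real.pi / 2) ^ (1 / 4 : ℝ) : ℝ) * (starRingEnd ℂ) (bargmannPhase w)) • normalizedKernel w

theorem rpow_quarter_sq : ((Real.pi / 2) ^ (1 / 4 : ℝ) : ℝ) ^ 2 = Real.sqrt (Real.pi / 2) := by
  rw [← Real.rpow_natCast, ← Real.rpow_mul (by positivity), Real.sqrt_eq_rpow]
  norm_num

/-- Expanding `(w + z̄)²/2` leaves the cross term `w z̄` of the Fock kernel; what depends on `w` or
`z` alone is absorbed by the phases and normalizations, and `√(π/2)` by the two factors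
`(π/2)^{1/4}`. -/
theorem inner_bargmannAtom_bargmannAtom (w z : ℂ) :
    inner ℂ (bargmannAtom w) (bargmannAtom z) = inner ℂ (gaborAtom w) (gaborAtom z) := by
  rw [bargmannAtom, bargmannAtom, inner_smul_left, inner_smul_right,
    FockSpace.inner_normalizedKernel_normalizedKernel, inner_gaborAtom_gaborAtom,
    ← rpow_quarter_sq, map_mul, Complex.conj_conj, Complex.conj_ofReal, bargmannPhase,
    bargmannPhase, ← Complex.exp_conj]
  have h : (w + (starRingEnd ℂ) z) ^ 2 / 2 - (w.re : ℂ) ^ 2 - (z.re : ℂ) ^ 2 =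
      (w ^ 2 / 2 - (w.re : ℂ) ^ 2 + (‖w‖ : ℂ) ^ 2 / 2) +
      (starRingEnd ℂ) (z ^ 2 / 2 - (z.re : ℂ) ^ 2 + (‖z‖ : ℂ) ^ 2 / 2) +
      (-(‖w‖ : ℂ) ^ 2 / 2 - (‖z‖ : ℂ) ^ 2 / 2 + w * (starRingEnd ℂ) z) := by
    simp only [map_add, map_sub, map_div₀, map_pow, Complex.conj_ofReal, map_ofNat]
    ring
  rw [h, Complex.exp_add _ (-(‖w‖ : ℂ) ^ 2 / 2 - _ + _),
    Complex.exp_add _ ((starRingEnd ℂ) _), Complex.ofReal_pow]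
  ring

theorem norm_inner_bargmannAtom_sq (F : FockSpace) (w : ℂ) :
    ‖inner ℂ F (bargmannAtom w)‖ ^ 2 =
      Real.sqrt (Real.pi / 2) * ‖inner ℂ F (normalizedKernel w)‖ ^ 2 := by
  rw [bargmannAtom, inner_smul_right, norm_mul, mul_pow, norm_mul, mul_pow, RCLike.norm_conj,
    norm_bargmannPhase, one_pow, mul_one, Complex.norm_real, Real.norm_eq_abs, sq_abs,
    rpow_quarter_sq]

theorem eq_zero_of_inner_bargmannAtom {F : FockSpace}
    (h : ∀ w, inner ℂ (bargmannAtom w) F = 0) : F = 0 := by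
  refine FockSpace.eq_zero_of_inner_normalizedKernel fun w => ?_
  have h1 := norm_inner_bargmannAtom_sq F w
  rw [norm_inner_symm, h, norm_zero, norm_inner_symm] at h1
  have h2 : Real.sqrt (Real.pi / 2) ≠ 0 := by positivity
  have h3 := (mul_eq_zero.1 (h1.symm.trans (zero_pow two_ne_zero))).resolve_left h2
  exact norm_eq_zero.1 ((pow_eq_zero_iff two_ne_zero).1 h3)

/-- The Bargmann transform: a unitary map carrying time-frequency shifts of the Gauss window to
multiples of normalized reproducing kernels. -/
theorem exists_bargmann_transform :
    ∃ U : L2R ≃ₗᵢ[ℂ] FockSpace, ∀ w, U (gaborAtom w) = bargmannAtom w :=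
  exists_linearIsometryEquiv_of_inner_eq (fun _ => eq_zero_of_inner_gaborAtom)
    (fun _ => eq_zero_of_inner_bargmannAtom) fun w z => (inner_bargmannAtom_bargmannAtom w z).symm

theorem isFrame_gaborAtom_iff (z : ℕ → ℂ) :
    IsFrame (fun n => gaborAtom (z n)) ↔ IsFrame fun n => normalizedKernel (z n) := by
  obtain ⟨U, hU⟩ := exists_bargmann_transform
  have hpos : 0 < Real.sqrt (Real.pi / 2) := by positivity
  have key : ∀ f w, ‖inner ℂ f (gaborAtom w)‖ ^ 2 =
      Real.sqrt (Real.pi / 2) * ‖inner ℂ (U f) (normalizedKernel w)‖ ^ 2 := fun f w => by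
    rw [← norm_inner_bargmannAtom_sq, ← hU, U.inner_map_map]
  constructor
  · refine IsFrame.of_linearIsometryEquiv U.symm (inv_pos.2 hpos) fun F n => ?_
    rw [key, U.apply_symm_apply, inv_mul_cancel_left₀ hpos.ne']
  · exact IsFrame.of_linearIsometryEquiv U hpos fun f n => key f (z n)

theorem isGaborFrame_gaussWindow_iff {a b : ℕ → ℝ} {z : ℕ → ℂ}
    (hz : ∀ n, z n = (a n : ℂ) - (Real.pi : ℂ) * (b n : ℂ) * Complex.I) :
    IsGaborFrame a b gaussWindow ↔ IsFrame fun n => gaborAtom (z n) := by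
  have h : ∀ n, gaborAtom (z n) = modulation (b n) (translation (a n) gaussWindow) := fun n => by
    have hre : (z n).re = a n := by simp [hz]
    have him : -(z n).im / Real.pi = b n := by simp [hz, Real.pi_ne_zero]
    rw [gaborAtom, hre, him]
  simp only [IsGaborFrame, h]

end FockGabor
end

theorem theorem13 (a b : ℕ → ℝ) (z : ℕ → ℂ)
    (hz : ∀ n, z n = (a n : ℂ) - (Real.pi : ℂ) * (b n : ℂ) * Complex.I)
    (hdistinct : Function.Injective z) :
    List.TFAE
      [FockGabor.IsGaborFrame a b FockGabor.gaussWindow,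
       FockGabor.IsSampling z,
       FockGabor.AtomicDecomposition z] := by
  rw [FockGabor.isGaborFrame_gaussWindow_iff hz, FockGabor.isFrame_gaborAtom_iff,
    FockGabor.isSampling_iff_isFrame, FockGabor.atomicDecomposition_iff_isFrame]
  tfae_have 1 ↔ 2 := Iff.rfl
  tfae_have 2 ↔ 3 := Iff.rfl
  tfae_finish
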